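/- Let $\mathbb{N}=\{1,2,3,\dots\}$ and let $\mathbb{N}_0=\mathbb{N}\cup\{0\}$. A \emph{system} $(X,T)$ is a compact metric space $X$ together with a continuous map $T:X\to X$. A point $x\in X$ is \emph{transitive} if its forward orbit $\{T^nx : n\in\mathbb{N}_0\}$ is dense in $X$. The system is \emph{minimal} if every point of $X$ is transitive, and \emph{totally minimal} if $(X,T^n)$ is minimal for every $n\in\mathbb{N}$. Let $\mathcal{C}$ be a class of systems. A set $S\subset\mathbb{N}$ is an \emph{interpolation set for $\mathcal{C}$} if for every bounded function $f:S\to\mathbb{C}$ there exist a system $(X,T)\in\mathcal{C}$, a transitive point $x\in X$ and a continuous function $F:X\to\mathbb{C}$ such that $F(T^nx)=f(n)$ for every $n\in S$. For $k\in\mathbb{N}$, $S$ is a \emph{weak interpolation set of order $k$ for $\mathcal{C}$} if the same holds for every function $f:S\to\{0,1,\dots,k-1\}$ (in place of every bounded $f:S\to\mathbb{C}$), and it is a \emph{weak interpolation set of all orders for $\mathcal{C}$} if it is a weak interpolation set of order $k$ for $\mathcal{C}$ for every $k\in\mathbb{N}$. A set $A\subset\mathbb{N}$ is \emph{syndetic}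 if there is $k\in\mathbb{N}$ with $\mathbb{N}\subset A\cup(A-1)\cup\dots\cup(A-k)$; a set $B\subset\mathbb{N}$ is \emph{thick} if it contains arbitrarily long intervals $\{m,m+1,\dots,n\}$; a set is \emph{piecewise syndetic} if it is the intersection of a syndetic set and a thick set. \textbf{Theorem.} Let $S\subset\mathbb{N}$. The following are equivalent: \begin{enumerate} \item $S$ is a weak interpolation set of order $2$ for minimal systems; \item $S$ is a weak interpolation set of all orders for minimal systems; \item $S$ is an interpolation set for minimal systems; \item $S$ is an interpolation set for totally minimal systems; \item $S$ is not piecewise syndetic. \end{enumerate} -/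

import Mathlib

universe u

namespace InterpolationSets

/-- A topological dynamical system `(X, T)`: a compact metric space `X` together with a
continuous map `T : X → X`. -/
structure DynSystem : Type (u + 1) where
  /-- The underlying space `X`. -/
  carrier : Type u
  [metric : MetricSpace carrier]
  [compact : CompactSpace carrier]
  /-- The continuous map `T`. -/
  map : C(carrier, carrier)

attribute [instance] DynSystem.metric DynSystem.compact

namespace DynSystem

/-- The system `(X, T ^ n)`. -/
def iter (X : DynSystem.{u}) (n : ℕ) : DynSystem.{u} where
  carrier := X.carrier
  map := ⟨X.map^[n], X.map.continuous.iterate n⟩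

/-- The forward orbit `{T ^ n x : n = 0, 1, 2, …}` of a point. -/
def orbit (X : DynSystem.{u}) (x : X.carrier) : Set X.carrier :=
  Set.range fun n : ℕ => X.map^[n] x

/-- A point is transitive if its forward orbit is dense. -/
def IsTransitivePoint (X : DynSystem.{u}) (x : X.carrier) : Prop :=
  Dense (X.orbit x)

/-- A system is minimal if the forward orbit of every point is dense. -/
def IsMinimal (X : DynSystem.{u}) : Prop :=
  ∀ x : X.carrier, Dense (X.orbit x)

/-- A system `(X, T)` is totally minimal if `(X, T ^ n)` is minimal for every `n ≥ 1`. -/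
def IsTotallyMinimal (X : DynSystem.{u}) : Prop :=
  ∀ n : ℕ, 1 ≤ n → (X.iter n).IsMinimal

end DynSystem

/-- The class of minimal systems. -/
def minimalSystems : Set DynSystem.{u} := {X | X.IsMinimal}

/-- The class of totally minimal systems. -/
def totallyMinimalSystems : Set DynSystem.{u} := {X | X.IsTotallyMinimal}

/-- `S` is a (strong) interpolation set for the class `C`: every bounded `f : S → ℂ` is of the
form `f n = F (T ^ n x)` for some system in `C`, some transitive point `x` and some continuous
complex-valued `F`. -/
def IsInterpolationSet (C : Set DynSystem.{u}) (S : Set ℕ+) : Prop :=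
  ∀ f : S → ℂ, Bornology.IsBounded (Set.range f) →
    ∃ X ∈ C, ∃ x : X.carrier, X.IsTransitivePoint x ∧
      ∃ F : C(X.carrier, ℂ), ∀ n : S, F (X.map^[((n : ℕ+) : ℕ)] x) = f n

/-- `S` is a weak interpolation set of order `k` for the class `C`: the interpolation property
for functions `f : S → {0, …, k - 1}`. -/
def IsWeakInterpolationSet (k : ℕ) (C : Set DynSystem.{u}) (S : Set ℕ+) : Prop :=
  ∀ f : S → Fin k,
    ∃ X ∈ C, ∃ x : X.carrier, X.IsTransitivePoint x ∧
      ∃ F : C(X.carrier, ℂ), ∀ n : S, F (X.map^[((n : ℕ+) : ℕ)] x) = ((f n : ℕ) : ℂ)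

/-- `S` is a weak interpolation set of all orders for the class `C`. -/
def IsWeakInterpolationSetAllOrders (C : Set DynSystem.{u}) (S : Set ℕ+) : Prop :=
  ∀ k : ℕ, 1 ≤ k → IsWeakInterpolationSet k C S

/-- `S` is syndetic: there is `k` such that `S ∪ (S - 1) ∪ … ∪ (S - k)` contains all positive
integers. -/
def IsSyndetic (S : Set ℕ+) : Prop :=
  ∃ k : ℕ+, ∀ n : ℕ+, ∃ s ∈ S, n ≤ s ∧ s ≤ n + k

/-- `S` is thick: it contains arbitrarily long intervals. -/
def IsThick (S : Set ℕ+) : Prop :=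
  ∀ k : ℕ+, ∃ m : ℕ+, Set.Icc m (m + k) ⊆ S

/-- `S` is piecewise syndetic: it is the intersection of a syndetic set and a thick set. -/
def IsPiecewiseSyndetic (S : Set ℕ+) : Prop :=
  ∃ A B : Set ℕ+, IsSyndetic A ∧ IsThick B ∧ S = A ∩ B

end InterpolationSets

/-! ### Weak interpolation of order 2 excludes piecewise syndetic sets. -/

namespace InterpolationSets

/-! Two implications carry the content; the others only enlarge the class of systems or restrict the
functions.

(1 ⇒ 5) In a minimal system every word read along an orbit, up to a small error, recurs with bounded
gaps. A piecewise syndetic `S` has arbitrarily long runs of blocks of length `l` that it meets in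
more than log₂ `l` points, so a colouring of one block can contradict all `l` placements of a given
word. Doing this for each word on long runs (`exists_nonrecurrent_coloring`) gives a 0-1 function
that no minimal system interpolates.

(5 ⇒ 4) Otherwise `S` has gaps of every length at bounded distances, and these are arranged in a
hierarchy (`WindowTower`). The values on `S` are kept, and each maximal window is filled with copies
of the prefix of length `size j` at period `size j + 1`, so that copies start in every residue class
modulo `size j`. Since each `d` divides `size j` for large `j`, all words recur with bounded gaps
along steps of `d` (`Fills.covers`, `Fills.exists_recurrence`), and the orbit closure under the
shift is totally minimal (`exists_totallyMinimal_of_recurrence`). -/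

theorem exists_forall_exists_ne {l : ℕ} (Q : Finset ℕ) (hQ : l < 2 ^ Q.card)
    (h : ℕ → ℕ → Bool) : ∃ g : ℕ → Bool, ∀ p < l, ∃ n ∈ Q, g n ≠ h p n := by
  classical
  -- The forbidden patterns restrict to fewer than `2 ^ Q.card` functions on `Q`.
  have hcard : ((Finset.range l).image fun p => (fun n : Q => h p n)).card <
      (Finset.univ : Finset (Q → Bool)).card := by
    refine Finset.card_image_le.trans_lt ?_
    simpa using hQ
  obtain ⟨g, -, hg⟩ := Finset.exists_mem_notMem_of_card_lt_card hcard
  refine ⟨fun n => if hn : n ∈ Q then g ⟨n, hn⟩ else false, fun p hp => ?_⟩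
  by_contra! hcon
  refine hg (Finset.mem_image.2 ⟨p, Finset.mem_range.2 hp, ?_⟩)
  funext n
  rw [← hcon n n.2, dif_pos n.2]

/-- A colouring of `ℕ` that takes each colour on long admissible intervals. -/
theorem exists_coloring_of_frequently {W : Type*} [Countable W] [Nonempty W]
    (P : ℕ → ℕ → Prop) (hP : ∀ len N, ∃ b, N ≤ b ∧ P len b) :
    ∃ c : ℕ → W, ∀ u len, ∃ b, P len b ∧ ∀ x, b ≤ x → x < b + len → c x = u := by
  obtain ⟨e, he⟩ := exists_surjective_nat (W × ℕ)
  choose next hle hnext using hP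
  -- Disjoint intervals are placed greedily from left to right, one for each enumerated pair
  -- (colour, length).
  obtain ⟨b, hb, hstep⟩ : ∃ b : ℕ → ℕ, (∀ j, P (e j).2 (b j)) ∧
      ∀ j, b j + (e j).2 ≤ b (j + 1) := by
    refine ⟨fun j => Nat.rec (next (e 0).2 0) (fun j bj => next (e (j + 1)).2 (bj + (e j).2)) j,
      ?_, fun j => hle _ _⟩
    rintro (_ | j)
    · exact hnext _ _
    · exact hnext _ _
  have hlt : ∀ i j, i < j → b i + (e i).2 ≤ b j := by
    intro i j hij
    induction hij with
    | refl => exact hstep i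
    | step _ ih => exact ih.trans ((Nat.le_add_right _ _).trans (hstep _))
  classical
  let c : ℕ → W := fun x =>
    if h : ∃ j, b j ≤ x ∧ x < b j + (e j).2 then (e h.choose).1 else Classical.arbitrary W
  refine ⟨c, fun u len => ?_⟩
  obtain ⟨j, hj⟩ := he (u, len)
  have hj2 : (e j).2 = len := by rw [hj]
  refine ⟨b j, hj2 ▸ hb j, fun x h1 h2 => ?_⟩
  rw [← hj2] at h2
  have hex : ∃ j, b j ≤ x ∧ x < b j + (e j).2 := ⟨j, h1, h2⟩
  have h3 := hex.choose_spec
  have : hex.choose = j := by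
    rcases lt_trichotomy hex.choose j with h | h | h
    · have := hlt _ _ h
      omega
    · exact h
    · have := hlt _ _ h
      omega
  simp only [c]
  rw [dif_pos hex, this, hj]

/-- By minimality the preimages of `U` cover `X`; compactness bounds the exponent. -/
theorem DynSystem.IsMinimal.exists_iterate_mem {X : DynSystem.{u}} (hX : X.IsMinimal)
    {U : Set X.carrier} (hU : IsOpen U) (hne : U.Nonempty) :
    ∃ G, ∀ y, ∃ n ≤ G, X.map^[n] y ∈ U := by
  obtain ⟨G, hG⟩ := isCompact_univ.elim_directed_cover
    (fun G : ℕ => ⋃ n ∈ Set.Iic G, X.map^[n] ⁻¹' U)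
    (fun G => isOpen_biUnion fun n _ => hU.preimage (X.map.continuous.iterate n))
    (fun y _ => by
      obtain ⟨_, ⟨n, rfl⟩, hy⟩ := (hX y).exists_mem_open hU hne
      exact Set.mem_iUnion.2 ⟨n, Set.mem_biUnion (Set.self_mem_Iic) hy⟩)
    (directed_of_isDirected_le fun a b hab => Set.biUnion_subset_biUnion_left
      (Set.Iic_subset_Iic.2 hab))
  refine ⟨G, fun y => ?_⟩
  obtain ⟨n, hn, h⟩ := Set.mem_iUnion₂.1 (hG (Set.mem_univ y))
  exact ⟨n, hn, h⟩

/-- On a piecewise syndetic set there is a colouring such that, for some `L`, no word of length `L`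
recurs with bounded gaps. -/
theorem exists_nonrecurrent_coloring {S : Set ℕ+} (hS : IsPiecewiseSyndetic S) :
    ∃ L, ∃ g : ℕ → Bool, ∀ (u : ℕ → Bool) (G : ℕ), ∃ m, ∀ p, m ≤ p → p ≤ m + G →
      ∃ n : ℕ+, n ∈ S ∧ p ≤ n ∧ n < p + L ∧ g n ≠ u (n - p) := by
  classical
  obtain ⟨A, B, ⟨k, hA⟩, hB, rfl⟩ := hS
  obtain ⟨K, hK⟩ : ∃ K, K = (k : ℕ) + 1 := ⟨_, rfl⟩
  -- A block splits into `4 * K` intervals of length `K`, each meeting `A`, while `l < 2 ^ (4 * K)`.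
  obtain ⟨l, hl⟩ : ∃ l, l = 4 * K * K := ⟨_, rfl⟩
  have hpow : l < 2 ^ (4 * K) := by
    have h1 : K < 2 ^ K := Nat.lt_two_pow_self
    have h2 : 2 * K ≤ 2 ^ K * K := Nat.mul_le_mul_right _ (by
      calc 2 = 2 ^ 1 := rfl
        _ ≤ 2 ^ K := Nat.pow_le_pow_right (by norm_num) (by omega))
    have h3 : 2 * K < 2 ^ (2 * K) := Nat.lt_two_pow_self
    calc l = (2 * K) * (2 * K) := by rw [hl]; ring
      _ < 2 ^ (2 * K) * 2 ^ (2 * K) := Nat.mul_lt_mul'' h3 h3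
      _ = 2 ^ (4 * K) := by rw [← pow_add]; congr 1; ring
  have hl0 : 0 < l := by rw [hl, hK]; positivity
  let Q : ℕ → Finset ℕ := fun q =>
    (Finset.Ico (q * l) ((q + 1) * l)).filter fun n => ∃ s ∈ A ∩ B, (s : ℕ) = n
  have hQ : ∀ q, 1 ≤ q → (∀ s : ℕ+, q * l ≤ s → (s : ℕ) < (q + 1) * l → s ∈ B) →
      4 * K ≤ (Q q).card := by
    intro q hq hqB
    have hql : 0 < q * l := by positivity
    have hex : ∀ x, ∃ s : ℕ+, s ∈ A ∧ q * l + x * K ≤ s ∧ (s : ℕ) < q * l + (x + 1) * K := by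
      intro x
      obtain ⟨P, hP⟩ : ∃ P : ℕ+, (P : ℕ) = q * l + x * K := ⟨⟨_, by omega⟩, rfl⟩
      obtain ⟨s, hs, h1, h2⟩ := hA P
      have h1' : q * l + x * K ≤ (s : ℕ) := hP ▸ (PNat.coe_le_coe _ _).2 h1
      have h2' : (s : ℕ) ≤ q * l + x * K + k := by simpa [hP] using (PNat.coe_le_coe _ _).2 h2
      have : (x + 1) * K = x * K + K := by ring
      exact ⟨s, hs, h1', by omega⟩
    choose s hsA hs1 hs2 using hex
    rw [← Finset.card_range (4 * K)]
    refine Finset.card_le_card_of_injOn (fun x => (s x : ℕ)) (fun x hx => ?_) ?_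
    · have hx' : (x + 1) * K ≤ 4 * K * K := Nat.mul_le_mul_right _ (by simpa using hx)
      have h1 := hs1 x
      have h2 := hs2 x
      have h3 : (q + 1) * l = q * l + l := by ring
      have h4 : (s x : ℕ) < (q + 1) * l := by omega
      have h5 : q * l ≤ (s x : ℕ) := by omega
      simp only [Q, Finset.coe_filter, Set.mem_ofPred_eq, Finset.mem_Ico]
      exact ⟨⟨h5, h4⟩, s x, ⟨hsA x, hqB _ h5 h4⟩, rfl⟩
    · have hmono : ∀ x y, x < y → (s x : ℕ) < s y := by
        intro x y hxy
        have : (x + 1) * K ≤ y * K := Nat.mul_le_mul_right _ hxy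
        have h1 := hs1 y
        have h2 := hs2 x
        omega
      exact (strictMono_nat_of_lt_succ fun x => hmono x _ (Nat.lt_succ_self x)).injective.injOn
  -- A word of length `2 * l` starting anywhere in block `q` spans block `q + 1`, so the colours of
  -- block `q + 1` are chosen against the `l` starts in block `q`; hence the index `n / l - 1`
  -- below.
  have hdef : ∀ (q : ℕ) (u : Fin (2 * l) → Bool), ∃ g : ℕ → Bool,
      l < 2 ^ (Q (q + 1)).card → ∀ p < l, ∃ n ∈ Q (q + 1),
        g n ≠ if h : n - (q * l + p) < 2 * l then u ⟨_, h⟩ else false := by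
    intro q u
    by_cases h : l < 2 ^ (Q (q + 1)).card
    · obtain ⟨g, hg⟩ := exists_forall_exists_ne (Q (q + 1)) h
        fun p n => if h : n - (q * l + p) < 2 * l then u ⟨_, h⟩ else false
      exact ⟨g, fun _ => hg⟩
    · exact ⟨fun _ => false, fun h' => absurd h' h⟩
  choose g hg using hdef
  obtain ⟨c, hc⟩ := exists_coloring_of_frequently (W := Fin (2 * l) → Bool)
    (fun len b => ∀ s : ℕ+, b * l ≤ s → (s : ℕ) ≤ (b + len) * l → s ∈ B) (fun len N => by
      obtain ⟨P, hP⟩ : ∃ P : ℕ+, (P : ℕ) = (len + N + 1) * l := ⟨⟨_, by positivity⟩, rfl⟩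
      obtain ⟨m, hm⟩ := hB P
      have h1 := Nat.div_add_mod (m : ℕ) l
      have h2 := Nat.mod_lt (m : ℕ) hl0
      refine ⟨m / l + N + 1, (Nat.le_add_left _ _).trans (Nat.le_add_right _ _), fun s hs1 hs2 => hm ⟨?_, ?_⟩⟩
      · rw [← PNat.coe_le_coe]
        have : ((m : ℕ) / l + N + 1) * l = l * (m / l) + N * l + l := by ring
        omega
      · rw [← PNat.coe_le_coe, PNat.add_coe, hP]
        have h3 : ((m : ℕ) / l + N + 1 + len) * l = l * (m / l) + (len + N + 1) * l := by ring
        omega)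
  refine ⟨2 * l, fun n => g (n / l - 1) (c (n / l)) n, fun u G => ?_⟩
  obtain ⟨b, hb1, hb2⟩ := hc (fun i => u i) (G + 3)
  refine ⟨b * l + l, fun p hp1 hp2 => ?_⟩
  have hdm := Nat.div_add_mod p l
  have hml := Nat.mod_lt p hl0
  set q := p / l with hq
  have hbq : b + 1 ≤ q := by
    rw [hq, Nat.le_div_iff_mul_le hl0, add_mul, one_mul]
    exact hp1
  have hqG : q ≤ b + 1 + G := by
    rw [hq]
    refine Nat.le_of_lt_succ ((Nat.div_lt_iff_lt_mul hl0).2 ?_)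
    have h1 : (b + 1 + G).succ * l = b * l + l + G * l + l := by
      rw [Nat.succ_eq_add_one]; ring
    have h2 : G * 1 ≤ G * l := Nat.mul_le_mul_left _ hl0
    omega
  have hcard : l < 2 ^ (Q (q + 1)).card := hpow.trans_le
    (Nat.pow_le_pow_right (by norm_num) (hQ (q + 1) (by omega) fun s h1 h2 => hb1 s
      ((Nat.mul_le_mul_right l (by omega)).trans h1)
      (h2.le.trans (Nat.mul_le_mul_right l (by omega)))))
  obtain ⟨n, hn, hne⟩ := hg q (fun i => u i) hcard (p % l) hml
  simp only [Q, Finset.mem_filter, Finset.mem_Ico] at hn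
  obtain ⟨⟨hn1, hn2⟩, s, hs, rfl⟩ := hn
  have h1 : (q + 1) * l = l * q + l := by ring
  have h2 : (q + 1 + 1) * l = l * q + l + l := by ring
  have h3 : q * l = l * q := mul_comm _ _
  have hdiv : (s : ℕ) / l = q + 1 := Nat.div_eq_of_lt_le hn1 hn2
  refine ⟨s, hs, by omega, by omega, ?_⟩
  dsimp only
  rw [hdiv, Nat.add_sub_cancel, hb2 _ (by omega) (by omega)]
  rw [h3, hdm, dif_pos (by omega)] at hne
  exact hne

/-- Rounding `‖F‖` at 1/2 along the orbit of `x` gives a word. Whenever the orbit returns to `U`,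
the colours on `S` must agree with this word, and the returns have bounded gaps. -/
theorem not_isPiecewiseSyndetic_of_isWeakInterpolationSet_two {S : Set ℕ+}
    (hS : IsWeakInterpolationSet 2 minimalSystems.{u} S) : ¬ IsPiecewiseSyndetic S := by
  intro hps
  obtain ⟨L, g, hg⟩ := exists_nonrecurrent_coloring hps
  obtain ⟨X, hX, x, -, F, hF⟩ := hS fun n => if g (n : ℕ+) then 1 else 0
  let U : Set X.carrier := ⋂ i ∈ Set.Iio L, {y | dist (F (X.map^[i] y)) (F (X.map^[i] x)) < 1 / 2}
  have hU : IsOpen U := (Set.finite_Iio L).isOpen_biInter fun i _ =>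
    isOpen_lt ((F.continuous.comp (X.map.continuous.iterate i)).dist continuous_const)
      continuous_const
  have hxU : x ∈ U := Set.mem_iInter₂.2 fun i _ => by simp
  obtain ⟨G, hG⟩ := DynSystem.IsMinimal.exists_iterate_mem hX hU ⟨x, hxU⟩
  classical
  obtain ⟨m, hm⟩ := hg (fun i => decide (1 / 2 ≤ ‖F (X.map^[i] x)‖)) G
  obtain ⟨e, he, hmem⟩ := hG (X.map^[m] x)
  obtain ⟨n, hn, h1, h2, hne⟩ := hm (m + e) (by omega) (by omega)
  have h3 := Set.mem_iInter₂.1 hmem (n - (m + e)) (show _ < L by omega)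
  simp only [Set.mem_ofPred_eq] at h3
  rw [← Function.iterate_add_apply, ← Function.iterate_add_apply,
    show (n : ℕ) - (m + e) + e + m = n by omega, hF ⟨n, hn⟩] at h3
  apply hne
  cases hgn : g n
  · rw [eq_comm, decide_eq_false_iff_not, not_le]
    simpa [hgn] using h3
  · rw [eq_comm, decide_eq_true_iff]
    have h4 : dist (1 : ℂ) (F (X.map^[(n : ℕ) - (m + e)] x)) < 1 / 2 := by simpa [hgn] using h3
    rw [dist_eq_norm] at h4
    have h5 := norm_sub_norm_le (1 : ℂ) (F (X.map^[(n : ℕ) - (m + e)] x))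
    rw [norm_one] at h5
    linarith

/-! ### Gaps of `S` and the hierarchy of windows. -/

/-- The set of natural numbers underlying a set of positive integers. -/
def natSet (S : Set ℕ+) : Set ℕ := {n | ∃ s ∈ S, (s : ℕ) = n}

/-- A set that is not piecewise syndetic has arbitrarily long gaps, syndetically often. -/
theorem exists_gap_of_not_isPiecewiseSyndetic {S : Set ℕ+} (hS : ¬ IsPiecewiseSyndetic S)
    (k : ℕ) : ∃ R, ∀ m, ∃ n, m ≤ n ∧ n ≤ m + R ∧ ∀ x, n ≤ x → x ≤ n + k → x ∉ natSet S := by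
  by_contra! h
  apply hS
  -- `S ∪ Bᶜ` is always syndetic, and `B` is thick if the gaps fail to be syndetic.
  let B : Set ℕ+ := {n | ∃ s ∈ S, n ≤ s ∧ s ≤ n + k.succPNat}
  refine ⟨S ∪ Bᶜ, B, ⟨k.succPNat, fun n => ?_⟩, fun r => ?_, ?_⟩
  · by_cases hn : n ∈ B
    · obtain ⟨s, hs, h1, h2⟩ := hn
      exact ⟨s, Or.inl hs, h1, h2⟩
    · exact ⟨n, Or.inr hn, le_rfl, (PNat.lt_add_right n _).le⟩
  · obtain ⟨m, hm⟩ := h (r + 1)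
    refine ⟨m.succPNat, fun n hn => ?_⟩
    have h1 : m + 1 ≤ (n : ℕ) := by simpa using (PNat.coe_le_coe _ _).2 hn.1
    have h2 : (n : ℕ) ≤ m + 1 + r := by simpa using (PNat.coe_le_coe _ _).2 hn.2
    obtain ⟨x, hx1, hx2, s, hs, rfl⟩ := hm n (by omega) (by omega)
    refine ⟨s, hs, (PNat.coe_le_coe _ _).1 hx1, (PNat.coe_le_coe _ _).1 ?_⟩
    rw [PNat.add_coe, Nat.succPNat_coe]
    omega
  · ext n
    simp only [Set.mem_inter_iff, Set.mem_union, Set.mem_compl_iff]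
    constructor
    · exact fun hn => ⟨Or.inl hn, n, hn, le_rfl, (PNat.lt_add_right n _).le⟩
    · tauto

/-- A hierarchy of cells `[q * size j, (q + 1) * size j)` together with, in each cell of level
`j + 1`, a window of length `size j * (size j + 2)` that is disjoint from `S` and consists of
cells of level `j`. -/
structure WindowTower (S : Set ℕ) where
  /-- The length of the cells of each level. -/
  size : ℕ → ℕ
  /-- The left end of the window of level `j` in the `q`-th cell of level `j + 1`. -/
  start : ℕ → ℕ → ℕ
  size_pos : ∀ j, 0 < size j
  size_dvd : ∀ j, size j ∣ size (j + 1)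
  succ_dvd : ∀ j, j + 1 ∣ size (j + 1)
  dvd_start : ∀ j q, size j ∣ start j q
  le_start : ∀ j q, q * size (j + 1) ≤ start j q
  start_add_le : ∀ j q, start j q + size j * (size j + 2) ≤ (q + 1) * size (j + 1)
  free : ∀ j q x, start j q ≤ x → x < start j q + size j * (size j + 2) → x ∉ S

theorem exists_next_level {S : Set ℕ}
    (hS : ∀ k, ∃ R, ∀ m, ∃ n, m ≤ n ∧ n ≤ m + R ∧ ∀ x, n ≤ x → x ≤ n + k → x ∉ S)
    (j M : ℕ) (hM : 0 < M) :
    ∃ M' : ℕ, 0 < M' ∧ M ∣ M' ∧ j + 1 ∣ M' ∧ ∀ q, ∃ a, M ∣ a ∧ q * M' ≤ a ∧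
      a + M * (M + 2) ≤ (q + 1) * M' ∧ ∀ x, a ≤ x → x < a + M * (M + 2) → x ∉ S := by
  -- The extra `M` lets the left end of the gap be rounded up to a multiple of `M`.
  obtain ⟨R, hR⟩ := hS (M * (M + 2) + M)
  set C := R + (M * (M + 2) + M) + 1 with hC
  have hle : C ≤ M * (j + 1) * C := Nat.le_mul_of_pos_left _ (by positivity)
  refine ⟨M * (j + 1) * C, by positivity, ⟨(j + 1) * C, by ring⟩, ⟨M * C, by ring⟩, fun q => ?_⟩
  obtain ⟨n, h1, h2, h3⟩ := hR (q * (M * (j + 1) * C))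
  have hd := Nat.div_add_mod n M
  have hm := Nat.mod_lt n hM
  have he : M * (n / M + 1) = M * (n / M) + M := by ring
  refine ⟨M * (n / M + 1), ⟨_, rfl⟩, by omega, ?_, fun x hx1 hx2 => h3 x (by omega) (by omega)⟩
  rw [add_mul q 1, one_mul]
  omega

theorem exists_windowTower {S : Set ℕ}
    (hS : ∀ k, ∃ R, ∀ m, ∃ n, m ≤ n ∧ n ≤ m + R ∧ ∀ x, n ≤ x → x ≤ n + k → x ∉ S) :
    Nonempty (WindowTower S) := by
  choose next hpos hdvd hsucc hwin using exists_next_level hS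
  let size : ℕ → {M : ℕ // 0 < M} := fun n =>
    Nat.rec ⟨1, one_pos⟩ (fun j M => ⟨next j M.1 M.2, hpos j M.1 M.2⟩) n
  choose start h1 h2 h3 h4 using fun j => hwin j (size j).1 (size j).2
  exact ⟨⟨fun j => (size j).1, start, fun j => (size j).2, fun j => hdvd j _ _,
    fun j => hsucc j _ _, h1, h2, h3, h4⟩⟩

namespace WindowTower

variable {S : Set ℕ} (W : WindowTower S)

/-- The length of the windows of level `j`. -/
def len (j : ℕ) : ℕ := W.size j * (W.size j + 2)

/-- `n` lies in the `q`-th window of level `j`; the windows with `q = 0` are not used. -/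
def Mem (j q n : ℕ) : Prop := 1 ≤ q ∧ W.start j q ≤ n ∧ n < W.start j q + W.len j

/-- The `q`-th window of level `j` is not covered by a window of higher level. -/
def IsTop (j q : ℕ) : Prop := ∀ j' q' n, j < j' → W.Mem j q n → ¬ W.Mem j' q' n

theorem size_dvd_of_le {i j : ℕ} (h : i ≤ j) : W.size i ∣ W.size j := by
  induction h with
  | refl => exact dvd_rfl
  | step _ ih => exact ih.trans (W.size_dvd _)

theorem size_le_of_le {i j : ℕ} (h : i ≤ j) : W.size i ≤ W.size j :=
  Nat.le_of_dvd (W.size_pos j) (W.size_dvd_of_le h)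

theorem dvd_size {d j : ℕ} (hd : 1 ≤ d) (h : d ≤ j) : d ∣ W.size j := by
  obtain ⟨e, rfl⟩ : ∃ e, d = e + 1 := ⟨d - 1, by omega⟩
  exact (W.succ_dvd e).trans (W.size_dvd_of_le h)

theorem le_size (j : ℕ) : j ≤ W.size j := by
  rcases Nat.eq_zero_or_pos j with rfl | h
  · exact Nat.zero_le _
  · exact Nat.le_of_dvd (W.size_pos j) (W.dvd_size h le_rfl)

theorem len_le_size_succ (j : ℕ) : W.len j ≤ W.size (j + 1) := by
  have h1 := W.le_start j 0
  have h2 := W.start_add_le j 0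
  simp only [zero_add, one_mul] at h2
  exact le_trans (Nat.le_add_left _ _) h2

theorem two_mul_size_le_len (j : ℕ) : 2 * W.size j ≤ W.len j := by
  have h1 := W.size_pos j
  unfold len
  nlinarith

theorem Mem.size_succ_le {j q n : ℕ} (h : W.Mem j q n) : W.size (j + 1) ≤ n := by
  have h1 := W.le_start j q
  have h2 : 1 * W.size (j + 1) ≤ q * W.size (j + 1) := Nat.mul_le_mul_right _ h.1
  have := h.2.1
  omega

theorem Mem.div_eq {j q n : ℕ} (h : W.Mem j q n) : n / W.size (j + 1) = q := by
  have h1 := W.le_start j q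
  have h2 := W.start_add_le j q
  obtain ⟨-, h3, h4⟩ := h
  unfold len at h4
  exact Nat.div_eq_of_lt_le (by omega) (by omega)

/-- A window of level `j > i` is a union of cells of level `i + 1`. -/
theorem Mem.of_div_eq {i j q n n' : ℕ} (hij : i < j) (h : W.Mem j q n)
    (hn : n / W.size (i + 1) = n' / W.size (i + 1)) : W.Mem j q n' := by
  have hM := W.size_pos (i + 1)
  obtain ⟨A, hA⟩ := (W.size_dvd_of_le (Nat.succ_le_of_lt hij)).trans (W.dvd_start j q)
  obtain ⟨B, hB⟩ := W.size_dvd_of_le (Nat.succ_le_of_lt hij)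
  have hL : W.len j = W.size (i + 1) * (B * (W.size j + 2)) := by
    unfold len
    nth_rewrite 1 [hB]
    simp only [Nat.succ_eq_add_one, mul_assoc]
  obtain ⟨h1, h2, h3⟩ := h
  rw [hL, hA, Nat.succ_eq_add_one, ← mul_add] at h3
  rw [hA, Nat.succ_eq_add_one] at h2
  refine ⟨h1, ?_, ?_⟩
  · rw [hA, Nat.succ_eq_add_one, mul_comm, ← Nat.le_div_iff_mul_le hM, ← hn,
      Nat.le_div_iff_mul_le hM, mul_comm]
    exact h2
  · rw [hL, hA, Nat.succ_eq_add_one, ← mul_add, mul_comm, ← Nat.div_lt_iff_lt_mul hM, ← hn,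
      Nat.div_lt_iff_lt_mul hM, mul_comm]
    exact h3

theorem isTop_of_forall_not_mem {j q n : ℕ} (h : W.Mem j q n)
    (hn : ∀ j' q', j < j' → ¬ W.Mem j' q' n) : W.IsTop j q := by
  intro j' q' n' hj hm hm'
  exact hn j' q' hj (hm'.of_div_eq W hj ((hm.div_eq W).trans (h.div_eq W).symm))

/-- Since windows with `q = 0` are excluded, a window of level `j` contains `n` only if `j < n`; so
there is a highest one. -/
theorem exists_isTop {j q n : ℕ} (h : W.Mem j q n) :
    ∃ j' q', j ≤ j' ∧ W.Mem j' q' n ∧ W.IsTop j' q' := by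
  induction hk : n - j using Nat.strong_induction_on generalizing j q with
  | _ k ih =>
    by_cases hn : ∀ j' q', j < j' → ¬ W.Mem j' q' n
    · exact ⟨j, q, le_rfl, h, W.isTop_of_forall_not_mem h hn⟩
    · push Not at hn
      obtain ⟨j', q', hj, hm⟩ := hn
      have h1 := hm.size_succ_le W
      have h2 := W.le_size (j' + 1)
      obtain ⟨j'', q'', h3, h4, h5⟩ := ih (n - j') (by omega) hm rfl
      exact ⟨j'', q'', by omega, h4, h5⟩

theorem IsTop.unique {j q j' q' n : ℕ} (h : W.IsTop j q) (h' : W.IsTop j' q')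
    (hm : W.Mem j q n) (hm' : W.Mem j' q' n) : j = j' ∧ q = q' := by
  rcases lt_trichotomy j j' with hj | rfl | hj
  · exact absurd hm' (h _ _ _ hj hm)
  · exact ⟨rfl, (hm.div_eq W).symm.trans (hm'.div_eq W)⟩
  · exact absurd hm (h' _ _ _ hj hm')

/-! ### Sequences that fill the windows. -/

/-- A sequence fills the windows if each top window of level `j` consists of copies of the first
`size j` letters, separated by single letters. -/
def Fills {α : Type*} (w : ℕ → α) : Prop :=
  ∀ j q, 1 ≤ q → W.IsTop j q → ∀ d < W.len j, d % (W.size j + 1) < W.size j →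
    w (W.start j q + d) = w (d % (W.size j + 1))

end WindowTower

/-- Solves a self-referential copying rule: iterating `r` reaches a fixed point within `n` steps,
and `b` is read there. -/
theorem exists_eq_apply_of_le {α : Type*} (r : ℕ → ℕ) (hr : ∀ n, r n ≤ n) (b : ℕ → α) :
    ∃ w : ℕ → α, (∀ n, w n = w (r n)) ∧ (∀ n, r n = n → w n = b n) ∧ ∀ n, w n ∈ Set.range b := by
  have hfix : ∀ n, r (r^[n] n) = r^[n] n := by
    have key : ∀ k n, n ≤ k → r (r^[k] n) = r^[k] n := by
      intro k
      induction k with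
      | zero =>
        intro n hn
        have := hr n
        simp only [Function.iterate_zero, id]
        omega
      | succ k ih =>
        intro n hn
        rw [Function.iterate_succ_apply]
        rcases (hr n).lt_or_eq with h | h
        · exact ih _ (by omega)
        · rw [h, Function.iterate_fixed h, h]
    exact fun n => key n n le_rfl
  have hle : ∀ k n, n ≤ k → r^[k] n = r^[n] n := by
    intro k n h
    obtain ⟨e, rfl⟩ := Nat.exists_eq_add_of_le' h
    rw [Function.iterate_add_apply, Function.iterate_fixed (hfix n)]
  refine ⟨fun n => b (r^[n] n), fun n => ?_, fun n hn => ?_, fun n => ⟨_, rfl⟩⟩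
  · show b _ = b _
    rw [← hle n (r n) (hr n), ← Function.iterate_succ_apply, Function.iterate_succ_apply', hfix]
  · show b _ = b _
    rw [Function.iterate_fixed hn]

namespace WindowTower

variable {S : Set ℕ} (W : WindowTower S)

theorem exists_fills {α : Type*} (b : ℕ → α) :
    ∃ w : ℕ → α, W.Fills w ∧ (∀ n ∈ S, w n = b n) ∧ ∀ n, w n ∈ Set.range b := by
  classical
  -- The source in the prefix of a copied letter. Separators and points outside the windows, in
  -- particular those of `S`, are fixed.
  let r : ℕ → ℕ := fun n =>
    if h : ∃ p : ℕ × ℕ, W.Mem p.1 p.2 n ∧ W.IsTop p.1 p.2 then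
      if (n - W.start h.choose.1 h.choose.2) % (W.size h.choose.1 + 1) < W.size h.choose.1 then
        (n - W.start h.choose.1 h.choose.2) % (W.size h.choose.1 + 1) else n
    else n
  obtain ⟨w, h1, h2, h3⟩ := exists_eq_apply_of_le r (fun n => by
    dsimp only [r]
    split_ifs with h h'
    · exact (Nat.mod_le _ _).trans (Nat.sub_le _ _)
    · exact le_rfl
    · exact le_rfl) b
  refine ⟨w, fun j q hq ht d hd hlt => ?_, fun n hn => h2 n ?_, h3⟩
  · have hm : W.Mem j q (W.start j q + d) := ⟨hq, Nat.le_add_right _ _, by omega⟩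
    have hex : ∃ p : ℕ × ℕ, W.Mem p.1 p.2 (W.start j q + d) ∧ W.IsTop p.1 p.2 :=
      ⟨(j, q), hm, ht⟩
    obtain ⟨e1, e2⟩ := hex.choose_spec.2.unique W ht hex.choose_spec.1 hm
    have : r (W.start j q + d) = d % (W.size j + 1) := by
      dsimp only [r]
      rw [dif_pos hex, e1, e2, Nat.add_sub_cancel_left, if_pos hlt]
    rw [h1, this]
  · have : ¬ ∃ p : ℕ × ℕ, W.Mem p.1 p.2 n ∧ W.IsTop p.1 p.2 := by
      rintro ⟨p, hp, -⟩
      exact W.free _ _ _ hp.2.1 hp.2.2 hn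
    simp only [r, dif_neg this]

/-! ### Recurrence of prefixes in all residue classes. -/

/-- The interval `[m, m')` contains, for each residue modulo `size i`, a copy of the first
`size i` letters of `w` that starts in this residue class. -/
def Covers {α : Type*} (w : ℕ → α) (i m m' : ℕ) : Prop :=
  ∀ ρ, ∃ p, m ≤ p ∧ p + W.size i ≤ m' ∧ p ≡ ρ [MOD W.size i] ∧ ∀ x < W.size i, w (p + x) = w x

section Covers

variable {W} {α : Type*} {w : ℕ → α}

theorem Covers.mono {i m m' l l' : ℕ} (h : W.Covers w i m m') (h1 : l ≤ m) (h2 : m' ≤ l') :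
    W.Covers w i l l' := fun ρ => by
  obtain ⟨p, h3, h4, h5⟩ := h ρ
  exact ⟨p, by omega, by omega, h5⟩

theorem Covers.of_succ {i m m' : ℕ} (h : W.Covers w (i + 1) m m') : W.Covers w i m m' :=
  fun ρ => by
  obtain ⟨p, h3, h4, h5, h6⟩ := h ρ
  have := W.size_le_of_le (Nat.le_add_right i 1)
  exact ⟨p, h3, by omega, h5.of_dvd (W.size_dvd i), fun x hx => h6 x (by omega)⟩

/-- Translation permutes the residue classes, so covering depends only on the word read. The term
`(W.size i - 1) * n` stands for `-n`. -/
theorem Covers.shift {i m m' n n' : ℕ} (h : W.Covers w i m m') (hn : n + m' = n' + m)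
    (_hm : m ≤ m')
    (hw : ∀ x, m + x < m' → w (n + x) = w (m + x)) : W.Covers w i n n' := fun ρ => by
  have hM := W.size_pos i
  obtain ⟨p, h3, h4, h5, h6⟩ := h (ρ + m + (W.size i - 1) * n)
  obtain ⟨e, rfl⟩ := Nat.exists_eq_add_of_le h3
  refine ⟨n + e, by omega, by omega, ?_, fun x hx => ?_⟩
  · have h7 : m + (n + e) ≡ m + ρ [MOD W.size i] := by
      have h8 : m + (n + e) ≡ (ρ + m + (W.size i - 1) * n) + n [MOD W.size i] := by
        have := h5.add_right n
        rwa [show m + e + n = m + (n + e) by ring] at this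
      refine h8.trans ?_
      have : ρ + m + (W.size i - 1) * n + n = m + ρ + W.size i * n := by
        obtain ⟨k, hk⟩ : ∃ k, W.size i = k + 1 := ⟨W.size i - 1, by omega⟩
        rw [hk, Nat.add_sub_cancel]
        ring
      rw [this]
      simp [Nat.ModEq]
    exact Nat.ModEq.add_left_cancel' m h7
  · rw [add_assoc, hw _ (by omega), ← add_assoc, h6 x hx]

variable (hw : W.Fills w)
include hw

/-- The copies inside a top window. -/
theorem Fills.copy_eq {j q s x : ℕ} (hq : 1 ≤ q) (ht : W.IsTop j q) (hs : s ≤ W.size j)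
    (hx : x < W.size j) : w (W.start j q + (s * (W.size j + 1) + x)) = w x := by
  have h1 : (s * (W.size j + 1) + x) % (W.size j + 1) = x := by
    rw [mul_comm, Nat.mul_add_mod, Nat.mod_eq_of_lt (by omega)]
  rw [hw j q hq ht, h1]
  · have : s * (W.size j + 1) ≤ W.size j * (W.size j + 1) := Nat.mul_le_mul_right _ hs
    have h2 : W.len j = W.size j * (W.size j + 1) + W.size j := by unfold len; ring
    omega
  · omega

/-- The window starts at a multiple of `size j`, so its copy number `s` starts in the class of `s`.
-/
theorem Fills.covers_of_isTop {j q : ℕ} (hq : 1 ≤ q) (ht : W.IsTop j q) :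
    W.Covers w j (W.start j q) (W.start j q + W.len j) := fun ρ => by
  have hM := W.size_pos j
  have hlt := Nat.mod_lt ρ hM
  refine ⟨W.start j q + (ρ % W.size j) * (W.size j + 1), Nat.le_add_right _ _, ?_, ?_, ?_⟩
  · have : (ρ % W.size j) * (W.size j + 1) ≤ W.size j * (W.size j + 1) :=
      Nat.mul_le_mul_right _ hlt.le
    have h2 : W.len j = W.size j * (W.size j + 1) + W.size j := by unfold len; ring
    omega
  · obtain ⟨A, hA⟩ := W.dvd_start j q
    rw [hA, show W.size j * A + ρ % W.size j * (W.size j + 1)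
      = W.size j * (A + ρ % W.size j) + ρ % W.size j by ring]
    simp [Nat.ModEq]
  · intro x hx
    rw [add_assoc, hw.copy_eq hq ht hlt.le hx]

/-- A cell of level `i + 1` other than the first one either lies in a top window of higher level
or contains all copies. -/
theorem Fills.cell_cases {i q : ℕ} (hq : 1 ≤ q) :
    W.Covers w i (q * W.size (i + 1)) ((q + 1) * W.size (i + 1)) ∨
    ∃ j q', i < j ∧ W.IsTop j q' ∧ 1 ≤ q' ∧ W.start j q' ≤ q * W.size (i + 1) ∧
      (q + 1) * W.size (i + 1) ≤ W.start j q' + W.len j := by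
  have hM := W.size_pos (i + 1)
  by_cases h : ∃ j q', i < j ∧ W.Mem j q' (q * W.size (i + 1))
  · right
    obtain ⟨j, q', hj, hm⟩ := h
    obtain ⟨j', q'', hj', hm', ht⟩ := W.exists_isTop hm
    refine ⟨j', q'', by omega, ht, hm'.1, hm'.2.1, ?_⟩
    have h1 : (q + 1) * W.size (i + 1) - 1 = W.size (i + 1) * q + (W.size (i + 1) - 1) := by
      rw [add_mul, one_mul, mul_comm]; omega
    have := (hm'.of_div_eq W (i := i) (n' := (q + 1) * W.size (i + 1) - 1) (by omega) (by
      rw [h1, Nat.mul_add_div hM, Nat.mul_div_cancel _ hM,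
        Nat.div_eq_of_lt (by omega : W.size (i + 1) - 1 < W.size (i + 1)), add_zero])).2.2
    omega
  · left
    push Not at h
    have hlen : 0 < W.len i := by
      have := W.two_mul_size_le_len i
      have := W.size_pos i
      omega
    have hm : W.Mem i q (W.start i q) := ⟨hq, le_rfl, by omega⟩
    have ht : W.IsTop i q := by
      refine W.isTop_of_forall_not_mem hm fun j' q' hj hm' => h j' q' hj ?_
      exact hm'.of_div_eq W hj (by rw [hm.div_eq W, Nat.mul_div_cancel _ hM])
    exact (hw.covers_of_isTop hq ht).mono (W.le_start i q) (W.start_add_le i q)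

end Covers

end WindowTower

namespace WindowTower

section Covers

variable {S : Set ℕ} {W : WindowTower S} {α : Type*} {w : ℕ → α} (hw : W.Fills w)
include hw

/-- Windows of level above `i` start too far right to contain the cell `q = 1` of level `i + 1`. -/
theorem Fills.covers_zero (i : ℕ) : W.Covers w i 0 (W.len (i + 1)) := by
  have hM := W.size_pos (i + 1)
  have h2 := W.two_mul_size_le_len (i + 1)
  rcases hw.cell_cases (i := i) (q := 1) le_rfl with h | ⟨j, q, hj, ht, hq, h3, -⟩
  · exact h.mono (Nat.zero_le _) (by omega)
  · exfalso
    have h4 := W.le_start j q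
    have h5 : 1 * W.size (j + 1) ≤ q * W.size (j + 1) := Nat.mul_le_mul_right _ hq
    have h6 := W.len_le_size_succ j
    have h7 := W.two_mul_size_le_len j
    have h8 := W.size_le_of_le (Nat.succ_le_of_lt hj)
    simp only [Nat.succ_eq_add_one] at h8
    omega

theorem Fills.covers_copy_end {i j q s : ℕ} (hq : 1 ≤ q) (ht : W.IsTop j q) (hs : s ≤ W.size j)
    (hj : W.len (i + 1) ≤ W.size j)
    (hc : W.Covers w i (W.size j - W.len (i + 1)) (W.size j)) :
    W.Covers w i (W.start j q + s * (W.size j + 1) + W.size j - W.len (i + 1))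
      (W.start j q + s * (W.size j + 1) + W.size j) := by
  refine hc.shift (by omega) (Nat.sub_le _ _) fun x hx => ?_
  rw [← hw.copy_eq hq ht hs hx]
  congr 1
  omega

/-- If the last cell of level `i + 1` before `size j` lies in a higher top window, of level `k`,
then alignment makes that window end exactly at `size j`. Either `k = i + 1` and the window covers,
or it ends with a copy of the prefix of length `size k` and induction applies. -/
theorem Fills.covers_size {i j : ℕ} (hij : i + 2 ≤ j) :
    W.Covers w i (W.size j - W.len (i + 1)) (W.size j) := by
  induction j using Nat.strong_induction_on with
  | _ j ih =>
    have hM := W.size_pos (i + 1)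
    have hD := W.two_mul_size_le_len (i + 1)
    have hDj := (W.len_le_size_succ (i + 1)).trans (W.size_le_of_le hij)
    obtain ⟨e, he⟩ := W.size_dvd_of_le (show i + 1 ≤ j by omega)
    obtain ⟨q, rfl⟩ : ∃ q, e = q + 2 := by
      refine ⟨e - 2, ?_⟩
      have : 2 ≤ e := by
        by_contra! h
        have : W.size (i + 1) * e ≤ W.size (i + 1) * 1 := Nat.mul_le_mul_left _ (by omega)
        omega
      omega
    have hj1 : W.size j = (q + 1 + 1) * W.size (i + 1) := by rw [he, mul_comm]
    have hj2 : W.size j = (q + 1) * W.size (i + 1) + W.size (i + 1) := by rw [hj1]; ring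
    rcases hw.cell_cases (i := i) (q := q + 1) (by omega) with h | ⟨k, p, hk, ht, hp, h1, h2⟩
    · exact h.mono (by omega) hj1.ge
    · rw [← hj1] at h2
      have h3 := W.le_start k p
      have h4 : 1 * W.size (k + 1) ≤ p * W.size (k + 1) := Nat.mul_le_mul_right _ hp
      have hkj : k + 1 < j := by
        by_contra! h
        have := W.size_le_of_le h
        omega
      have hend : W.size j = W.start k p + W.len k := by
        obtain ⟨c, hc⟩ := W.size_dvd_of_le hkj.le
        have h5 := W.start_add_le k p
        have h6 : p * W.size (k + 1) < c * W.size (k + 1) := by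
          rw [mul_comm c, ← hc]; omega
        have h7 := Nat.lt_of_mul_lt_mul_right h6
        have h8 : (p + 1) * W.size (k + 1) ≤ c * W.size (k + 1) := Nat.mul_le_mul_right _ h7
        rw [mul_comm c, ← hc] at h8
        unfold len at h2 ⊢
        omega
      rcases (Nat.succ_le_of_lt hk).eq_or_lt with rfl | hk'
      · exact (hw.covers_of_isTop hp ht).of_succ.mono (by rw [hend]; simp) hend.ge
      · have h9 := hw.covers_copy_end (i := i) hp ht le_rfl
          ((W.len_le_size_succ (i + 1)).trans (W.size_le_of_le hk')) (ih k (by omega) hk')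
        have h10 : W.size j = W.start k p + W.size k * (W.size k + 1) + W.size k := by
          rw [hend]; unfold len; ring
        rwa [← h10] at h9

theorem Fills.covers_copy_start {i j q s : ℕ} (hq : 1 ≤ q) (ht : W.IsTop j q)
    (hs : s ≤ W.size j) (hj : W.len (i + 1) ≤ W.size j) :
    W.Covers w i (W.start j q + s * (W.size j + 1))
      (W.start j q + s * (W.size j + 1) + W.len (i + 1)) := by
  refine (hw.covers_zero i).shift (by omega) (Nat.zero_le _) fun x hx => ?_
  rw [zero_add] at hx ⊢
  rw [← hw.copy_eq hq ht hs (show x < W.size j by omega)]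
  congr 1
  omega

theorem Fills.covers_window_start {i j q : ℕ} (hij : i < j) (hq : 1 ≤ q) (ht : W.IsTop j q) :
    W.Covers w i (W.start j q) (W.start j q + W.len (i + 1)) := by
  rcases (Nat.succ_le_of_lt hij).eq_or_lt with rfl | hk
  · exact (hw.covers_of_isTop hq ht).of_succ
  · simpa using hw.covers_copy_start (i := i) hq ht (Nat.zero_le _)
      ((W.len_le_size_succ (i + 1)).trans (W.size_le_of_le hk))

theorem Fills.covers_window_end {i j q : ℕ} (hij : i < j) (hq : 1 ≤ q) (ht : W.IsTop j q) :
    W.Covers w i (W.start j q + W.len j - W.len (i + 1)) (W.start j q + W.len j) := by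
  rcases (Nat.succ_le_of_lt hij).eq_or_lt with rfl | hk
  · simpa using (hw.covers_of_isTop hq ht).of_succ
  · have h := hw.covers_copy_end (i := i) hq ht le_rfl
      ((W.len_le_size_succ (i + 1)).trans (W.size_le_of_le hk)) (hw.covers_size hk)
    have : W.start j q + W.len j = W.start j q + W.size j * (W.size j + 1) + W.size j := by
      unfold len; ring
    rwa [this]

/-- Every sufficiently long interval contains copies of a given prefix in all residue classes. -/
theorem Fills.covers (i m : ℕ) : W.Covers w i m (m + 3 * W.len (i + 1)) := by
  -- The critical case is an interval strictly inside one higher window. It lies in a single copy,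
  -- and is then a translate of an interval starting earlier, or it contains the last or first `D`
  -- letters of a copy.
  induction m using Nat.strong_induction_on with
  | _ m ih =>
    set D := W.len (i + 1) with hDdef
    set M := W.size (i + 1) with hMdef
    have hM : 0 < M := W.size_pos (i + 1)
    have hD : 2 * M ≤ D := W.two_mul_size_le_len (i + 1)
    have hdm := Nat.div_add_mod (m + D) M
    have hlt := Nat.mod_lt (m + D) hM
    set q := (m + D) / M with hq
    have h1 : (q + 1) * M = M * q + M := by ring
    have h2 : (q + 1 + 1) * M = M * q + M + M := by ring
    rcases hw.cell_cases (i := i) (q := q + 1) (Nat.le_add_left 1 q) with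
      h | ⟨j, p, hj, ht, hp, h3, h4⟩
    · exact h.mono (by rw [← hMdef]; omega) (by rw [← hMdef]; omega)
    · rw [← hMdef] at h3 h4
      rcases le_or_gt m (W.start j p) with ha | ha
      · exact (hw.covers_window_start hj hp ht).mono ha (by omega)
      rcases le_or_gt (W.start j p + W.len j) (m + 3 * D) with hb | hb
      · exact (hw.covers_window_end hj hp ht).mono (by omega) hb
      rcases (Nat.succ_le_of_lt hj).eq_or_lt with rfl | hk
      · exact (hw.covers_of_isTop hp ht).of_succ.mono (by simp only [Nat.succ_eq_add_one] at *; omega)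
          (by simp only [Nat.succ_eq_add_one] at *; omega)
      have hDj : D ≤ W.size j := (W.len_le_size_succ (i + 1)).trans (W.size_le_of_le hk)
      have hlen : W.len j = W.size j * (W.size j + 1) + W.size j := by unfold len; ring
      obtain ⟨d, rfl⟩ := Nat.exists_eq_add_of_lt ha
      have hdm' := Nat.div_add_mod (d + 1) (W.size j + 1)
      have hlt' := Nat.mod_lt (d + 1) (Nat.succ_pos (W.size j))
      set s := (d + 1) / (W.size j + 1)
      set x := (d + 1) % (W.size j + 1)
      rw [mul_comm] at hdm'
      have hs : s ≤ W.size j := by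
        by_contra! h
        have : (W.size j + 1) * (W.size j + 1) ≤ s * (W.size j + 1) :=
          Nat.mul_le_mul_right _ h
        have h' : (W.size j + 1) * (W.size j + 1) = W.size j * (W.size j + 1) + W.size j + 1 := by
          ring
        omega
      rcases le_or_gt (x + 3 * D) (W.size j) with hx | hx
      · have h5 := W.le_start j p
        have h6 : 1 * W.size (j + 1) ≤ p * W.size (j + 1) := Nat.mul_le_mul_right _ hp
        have h7 := W.size_pos (j + 1)
        refine (ih x (by omega)).shift (by omega) (by omega) fun y hy => ?_
        rw [← hw.copy_eq hp ht hs (show x + y < W.size j by omega)]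
        congr 1
        omega
      · rcases le_or_gt (x + D) (W.size j) with hx' | hx'
        · exact (hw.covers_copy_end hp ht hs hDj (hw.covers_size hk)).mono (by omega) (by omega)
        · have hs' : s + 1 ≤ W.size j := by
            by_contra! h
            have : s = W.size j := by omega
            rw [this] at hdm'
            omega
          have h8 : (s + 1) * (W.size j + 1) = s * (W.size j + 1) + W.size j + 1 := by ring
          exact (hw.covers_copy_start hp ht hs' hDj).mono (by omega) (by omega)

/-- Total recurrence: every word of `w` recurs with bounded gaps in each arithmetic progression. -/
theorem Fills.exists_recurrence (c L d : ℕ) (hd : 1 ≤ d) :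
    ∃ G, ∀ m, ∃ n ≤ G, ∀ x < L, w (m + d * n + x) = w (c + x) := by
  obtain ⟨i, hi⟩ : ∃ i, i = c + L + d := ⟨_, rfl⟩
  have hi1 := W.le_size i
  refine ⟨3 * W.len (i + 1) + c, fun m => ?_⟩
  -- The residue is that of `m - c` modulo `d`, so the word at `c` reappears at `p + c ≡ m`.
  obtain ⟨p, h1, h2, h3, h4⟩ := hw.covers i m (m + c * (d - 1))
  have h5 : p + c ≡ m [MOD d] := by
    have h6 := (h3.of_dvd (W.dvd_size hd (by omega))).add_right c
    refine h6.trans ?_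
    have : m + c * (d - 1) + c = m + d * c := by
      obtain ⟨k, rfl⟩ : ∃ k, d = k + 1 := ⟨d - 1, by omega⟩
      rw [Nat.add_sub_cancel]
      ring
    rw [this]
    simp [Nat.ModEq]
  obtain ⟨n, hn⟩ := (Nat.modEq_iff_dvd' (by omega)).1 h5.symm
  have h7 : 1 * n ≤ d * n := Nat.mul_le_mul_right _ hd
  refine ⟨n, by omega, fun x hx => ?_⟩
  rw [← hn, ← h4 (c + x) (by omega)]
  congr 1
  omega

end Covers

end WindowTower

/-! ### The totally minimal orbit closure and the conclusion. -/

/-- A totally recurrent bounded sequence is the sequence of values of a continuous function along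
an orbit in a totally minimal system. -/
theorem exists_totallyMinimal_of_recurrence (w : ℕ → ℂ) (R : ℝ) (hR : ∀ n, ‖w n‖ ≤ R)
    (hw : ∀ c L d, 1 ≤ d → ∃ G, ∀ m, ∃ n ≤ G, ∀ x < L, w (m + d * n + x) = w (c + x)) :
    ∃ X ∈ totallyMinimalSystems.{u}, ∃ x : X.carrier, X.IsTransitivePoint x ∧
      ∃ F : C(X.carrier, ℂ), ∀ n, F (X.map^[n] x) = w n := by
  let σ : (ℕ → ℂ) → ℕ → ℂ := fun v x => v (x + 1)
  have hσ : Continuous σ := continuous_pi fun x => continuous_apply (x + 1)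
  have hσi : ∀ n v x, σ^[n] v x = v (x + n) := by
    intro n
    induction n with
    | zero => exact fun v x => rfl
    | succ n ih =>
      intro v x
      rw [Function.iterate_succ_apply, ih]
      exact congrArg v (by omega)
  let O : Set (ℕ → ℂ) := Set.range fun n => σ^[n] w
  let Z : Set (ℕ → ℂ) := closure O
  have hO : Set.MapsTo σ O O := by
    rintro _ ⟨n, rfl⟩
    exact ⟨n + 1, Function.iterate_succ_apply' _ _ _⟩
  have hZ : Set.MapsTo σ Z Z := hO.closure hσ
  have hZc : IsCompact Z := by
    refine (isCompact_univ_pi fun _ : ℕ => isCompact_closedBall (0 : ℂ) R).of_isClosed_subset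
      isClosed_closure (closure_minimal ?_ (isClosed_set_pi fun _ _ => Metric.isClosed_closedBall))
    rintro _ ⟨n, rfl⟩ x -
    rw [mem_closedBall_zero_iff]
    dsimp only
    rw [hσi]
    exact hR _
  have hdense : ∀ d, 1 ≤ d → ∀ y ∈ Z, Z ⊆ closure (Set.range fun k => σ^[d * k] y) := by
    intro d hd y hy
    refine closure_minimal ?_ isClosed_closure
    rintro _ ⟨c, rfl⟩
    have key : ∀ L, ∃ k, ∀ x < L, y (d * k + x) = w (c + x) := by
      intro L
      obtain ⟨G, hG⟩ := hw c L d hd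
      -- The bound `G` makes the union finite and `A` closed, so recurrence passes from the orbit to
      -- its closure.
      let A : Set (ℕ → ℂ) := ⋃ k ∈ Set.Iic G, ⋂ x ∈ Set.Iio L, {v | v (d * k + x) = w (c + x)}
      have hA : IsClosed A := (Set.finite_Iic G).isClosed_biUnion fun k _ =>
        isClosed_biInter fun x _ => isClosed_eq (continuous_apply _) continuous_const
      have hOA : O ⊆ A := by
        rintro _ ⟨m, rfl⟩
        obtain ⟨n, hn, h⟩ := hG m
        refine Set.mem_biUnion (show n ∈ Set.Iic G from hn) (Set.mem_iInter₂.2 fun x hx => ?_)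
        show σ^[m] w _ = _
        rw [hσi, ← h x hx]
        exact congrArg w (by ring)
      obtain ⟨k, -, hk⟩ := Set.mem_iUnion₂.1 (closure_minimal hOA hA hy)
      exact ⟨k, fun x hx => Set.mem_iInter₂.1 hk x hx⟩
    choose k hk using key
    refine mem_closure_of_tendsto (f := fun L => σ^[d * k L] y) (b := Filter.atTop)
      (tendsto_pi_nhds.2 fun x => ?_) (Filter.Eventually.of_forall fun L => ⟨k L, rfl⟩)
    refine tendsto_const_nhds.congr' ?_
    filter_upwards [Filter.eventually_gt_atTop x] with L hL
    rw [hσi, hσi, add_comm x, add_comm x, hk L x hL]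
  have : CompactSpace Z := isCompact_iff_compactSpace.1 hZc
  have hemb : Topology.IsEmbedding fun z : ULift.{u} Z => (z.down : ℕ → ℂ) :=
    Topology.IsEmbedding.subtypeVal.comp Homeomorph.ulift.isEmbedding
  have : TopologicalSpace.MetrizableSpace (ULift.{u} Z) := hemb.metrizableSpace
  let : MetricSpace (ULift.{u} Z) := TopologicalSpace.metrizableSpaceMetric _
  let T : C(ULift.{u} Z, ULift.{u} Z) :=
    ⟨fun z => ⟨⟨σ z.down, hZ z.down.2⟩⟩, continuous_uliftUp.comp
      ((hσ.comp (continuous_subtype_val.comp continuous_uliftDown)).subtype_mk _)⟩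
  have hT : ∀ n z, ((T^[n] z).down : ℕ → ℂ) = σ^[n] z.down := by
    intro n z
    induction n with
    | zero => rfl
    | succ n ih =>
      rw [Function.iterate_succ_apply', Function.iterate_succ_apply', ← ih]
      rfl
  have hmin : ∀ d, 1 ≤ d → ∀ z : ULift.{u} Z, Dense (Set.range fun k => (T^[d])^[k] z) := by
    intro d hd z z'
    rw [hemb.isInducing.closure_eq_preimage_closure_image, Set.mem_preimage, ← Set.range_comp]
    convert hdense d hd _ z.down.2 z'.down.2 using 3
    funext k
    simp only [Function.comp_apply]
    rw [← Function.iterate_mul, hT]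
  let X : DynSystem.{u} := ⟨ULift.{u} Z, T⟩
  let x : X.carrier := (⟨⟨w, subset_closure ⟨0, rfl⟩⟩⟩ : ULift.{u} Z)
  refine ⟨X, hmin, x, hmin 1 le_rfl x, ⟨fun z : ULift.{u} Z => z.down.1 0,
    (continuous_apply 0).comp (continuous_subtype_val.comp continuous_uliftDown)⟩, fun n => ?_⟩
  show ((T^[n] x).down : ℕ → ℂ) 0 = w n
  rw [hT, hσi, zero_add]

theorem isInterpolationSet_totallyMinimal_of_not_isPiecewiseSyndetic {S : Set ℕ+}
    (hS : ¬ IsPiecewiseSyndetic S) : IsInterpolationSet totallyMinimalSystems.{u} S := by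
  intro f hf
  obtain ⟨W⟩ := exists_windowTower (exists_gap_of_not_isPiecewiseSyndetic hS)
  let g : ℕ+ → ℂ := Function.extend Subtype.val f 0
  obtain ⟨R, hR⟩ := isBounded_iff_forall_norm_le.1 hf
  have hg : ∀ n, ‖g n‖ ≤ max R 0 := by
    intro n
    by_cases hn : n ∈ S
    · have : g n = f ⟨n, hn⟩ := Subtype.val_injective.extend_apply f 0 ⟨n, hn⟩
      rw [this]
      exact (hR _ ⟨_, rfl⟩).trans (le_max_left _ _)
    · have : g n = 0 := Function.extend_apply' _ _ _ (by rintro ⟨a, rfl⟩; exact hn a.2)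
      simp [this]
  obtain ⟨w, h1, h2, h3⟩ := W.exists_fills fun n => g n.toPNat'
  obtain ⟨X, hX, x, hx, F, hF⟩ := exists_totallyMinimal_of_recurrence.{u} w (max R 0)
    (fun n => by obtain ⟨k, hk⟩ := h3 n; rw [← hk]; exact hg _)
    (fun c L d hd => h1.exists_recurrence c L d hd)
  refine ⟨X, hX, x, hx, F, fun n => ?_⟩
  rw [hF, h2 _ ⟨n, n.2, rfl⟩, PNat.coe_toPNat']
  exact Subtype.val_injective.extend_apply f 0 n

end InterpolationSets
theorem mainTheorem1 (S : Set ℕ+) :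
    List.TFAE [
      InterpolationSets.IsWeakInterpolationSet 2 InterpolationSets.minimalSystems.{u} S,
      InterpolationSets.IsWeakInterpolationSetAllOrders InterpolationSets.minimalSystems.{u} S,
      InterpolationSets.IsInterpolationSet InterpolationSets.minimalSystems.{u} S,
      InterpolationSets.IsInterpolationSet InterpolationSets.totallyMinimalSystems.{u} S,
      ¬ InterpolationSets.IsPiecewiseSyndetic S] := by
  tfae_have 1 → 5 := InterpolationSets.not_isPiecewiseSyndetic_of_isWeakInterpolationSet_two
  tfae_have 5 → 4 :=
    InterpolationSets.isInterpolationSet_totallyMinimal_of_not_isPiecewiseSyndetic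
  tfae_have 4 → 3 := fun h f hf => by
    obtain ⟨X, hX, hx⟩ := h f hf
    exact ⟨X, hX 1 le_rfl, hx⟩
  tfae_have 3 → 2 := fun h k _ f =>
    h (fun n => ((f n : ℕ) : ℂ)) ((Set.finite_range fun i : Fin k => ((i : ℕ) : ℂ)).subset
      (by rintro _ ⟨n, rfl⟩; exact ⟨f n, rfl⟩)).isBounded
  tfae_have 2 → 1 := fun h => h 2 (by norm_num)
  tfae_finish
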